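/- Let $\alpha,\beta>-1$ be real and let $n\ge 0$ be an integer. Let $P_m^{(a,b)}$ denote the Jacobi polynomial of degree $m$, normalized by $P_m^{(a,b)}(1)=\binom{m+a}{m}$. Then $P_{n+1}^{(\alpha+1,\beta+1)}$ has $n+1$ distinct real roots $x_0<x_1<\dots<x_n$, and there are weights $\tilde w_0,\dots,\tilde w_n,\hat w_1,\hat w_2$ such that the Gauss–Lobatto quadrature rule $$\int_{-1}^1 (1-t)^\alpha(1+t)^\beta p(t)\,dt=\hat w_1\,p(-1)+\hat w_2\,p(1)+\sum_{j=0}^n\tilde w_j\,p(x_j)$$ holds for all real polynomials $p$ of degree at most $2n+3$. For any such weights, $\tilde w_j>0$ for all $j$, $\hat w_1>0$ and $\hat w_2>0$. Moreover, let $$C_n^{(a,b)}=(-1)^n\,\frac{\Gamma(2n+a+b+3)}{2^{\,n+1+\frac{a+b+1}{2}}}\,\frac{1}{\sqrt{(n+1)!\,\Gamma(n+a+b+2)\,\Gamma(n+a+2)\,\Gamma(n+b+2)}},$$ and recall that the barycentric weight of a node $v_i$ in a finite set of distinct nodes is $1/\prod_{k\ne i}(v_i-v_k)$. For the $n+3$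 nodes $\{-1,1\}\cup\{x_0,\dots,x_n\}$, the barycentric weights $\tilde\lambda_j$ at $x_j$, $\hat\lambda_1$ at $-1$ and $\hat\lambda_2$ at $1$ are $$\tilde\lambda_j=C_n^{(\alpha+1,\beta+1)}(-1)^{j+1}\sqrt{\tilde w_j}\quad(j=0,\dots,n),$$ $$\hat\lambda_1=C_n^{(\alpha+1,\beta+1)}\sqrt{(\beta+1)\hat w_1},\qquad \hat\lambda_2=C_n^{(\alpha+1,\beta+1)}(-1)^n\sqrt{(\alpha+1)\hat w_2}.$$ The same formulas with $C_n^{(\alpha+1,\beta+1)}$ replaced by $1$ give simplified barycentric weights, that is, numbers from which all the barycentric weights are obtained by multiplication by one common nonzero factor. -/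

import Mathlib

noncomputable section

open Polynomial

/-- The Jacobi polynomial `P_n^{(α,β)}` in the standard normalization
`P_n^{(α,β)}(1) = binom(n+α, n)`:
`P_n^{(α,β)}(x) = ∑_{s=0}^n binom(n+α, n-s) binom(n+β, s) ((x-1)/2)^s ((x+1)/2)^{n-s}`,
with generalized binomial coefficients. -/
def jacobiPoly (n : ℕ) (α β : ℝ) : ℝ[X] :=
  ∑ s ∈ Finset.range (n + 1),
    C (Ring.choose ((n : ℝ) + α) (n - s) * Ring.choose ((n : ℝ) + β) s) *
      (C (1 / 2) * (X - 1)) ^ s * (C (1 / 2) * (X + 1)) ^ (n - s)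

/-- The Jacobi weight function `(1-t)^α (1+t)^β`. -/
def jacobiWeight (α β t : ℝ) : ℝ := (1 - t) ^ α * (1 + t) ^ β

/-- The common factor `C_n^{(α,β)}` of the (unsimplified) barycentric weights. -/
def jacobiC (n : ℕ) (α β : ℝ) : ℝ :=
  (if Even n then 1 else -1) *
    (Real.Gamma (2 * n + α + β + 3) / (2 : ℝ) ^ ((n : ℝ) + 1 + (α + β + 1) / 2)) *
    (1 / √((n + 1).factorial * Real.Gamma (n + α + β + 2) *
      Real.Gamma (n + α + 2) * Real.Gamma (n + β + 2)))

/-- The `n + 3` Lobatto points: the interior points `x_0, …, x_n`, together with the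
preassigned points `y_1 = -1` (index `Sum.inr 0`) and `y_2 = 1` (index `Sum.inr 1`). -/
def lobattoNodes {n : ℕ} (x : Fin (n + 1) → ℝ) : Fin (n + 1) ⊕ Fin 2 → ℝ :=
  Sum.elim x ![-1, 1]

/-- The Gauss-Lobatto quadrature rule for the weight `(1-t)^α (1+t)^β`: the interior nodes
`x_0 < ⋯ < x_n` are the roots of `P_{n+1}^{(α+1,β+1)}`, and the rule with interior
weights `wt` and endpoint weights `wh 0` (at `-1`), `wh 1` (at `1`) is exact for all
polynomials of degree at most `2n+3`. -/
structure IsJacobiLobattoRule (α β : ℝ) {n : ℕ} (x wt : Fin (n + 1) → ℝ) (wh : Fin 2 → ℝ) :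
    Prop where
  strictMono : StrictMono x
  range_eq : Set.range x = {t : ℝ | (jacobiPoly (n + 1) (α + 1) (β + 1)).IsRoot t}
  exact_of_le : ∀ p : ℝ[X], p.natDegree ≤ 2 * n + 3 →
    ∫ t in (-1 : ℝ)..1, jacobiWeight α β t * p.eval t =
      wh 0 * p.eval (-1) + wh 1 * p.eval 1 + ∑ j, wt j * p.eval (x j)

/-- The barycentric weights `λ_i = 1 / ∏_{k ≠ i} (v_i - v_k)` of a finite family of nodes. -/
def barycentricWeight {ι : Type*} [Fintype ι] [DecidableEq ι] (v : ι → ℝ) (i : ι) : ℝ :=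
  1 / ∏ k ∈ Finset.univ.erase i, (v i - v k)

/-- `μ` is a family of simplified barycentric weights for the nodes `v`: it arises from the
barycentric weights by cancelling a common nonzero factor. -/
def IsSimplifiedBarycentricWeight {ι : Type*} [Fintype ι] [DecidableEq ι] (v μ : ι → ℝ) : Prop :=
  ∃ c : ℝ, c ≠ 0 ∧ ∀ i, barycentricWeight v i = c * μ i

end

/-!
Write `a = α + 1`, `b = β + 1`, `N = n + 1`, and let `p` be the monic multiple of `P_N^{(a,b)}`.

*Orthogonality and zeros.* The explicit sum gives the raising relation `jacobiPoly_raising`: the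
derivative of `(1-t)^(a+1) (1+t)^(b+1) P_N^{(a+1,b+1)}` is `-2(N+1) (1-t)^a (1+t)^b P_{N+1}^{(a,b)}`.
Integrating it by parts `N` times evaluates `∫ (1-t)^a (1+t)^b P_N q` for every `q` of degree at
most `N` as a Beta integral times the coefficient of `X^N` in `q`
(`jacobiIntegral_jacobiPoly_mul`); this is orthogonality and the norm at once. Rolle's theorem
applied to the same relation produces the `N` distinct zeros in `(-1,1)`
(`exists_strictMono_isRoot_jacobiPoly`). Orthogonality then makes the interpolatory rule at the
Lobatto nodes exact to degree `2n+3` (`exists_isJacobiLobattoRule`).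

*Weights.* Testing a rule on `(1-X²) ℓ_j²` with `ℓ_j = p / (X - x_j)`, on `(1-X) p²` and on
`(1+X) p²` isolates one weight each time, so every weight is an integral of a square divided by an
explicit value. These integrals are evaluated by one more integration by parts each
(`one_sub_sq_mul_jacobiIntegral_sq`, `jacobiIntegral_sq_of_orthogonal_right`,
`jacobiIntegral_sq_of_orthogonal_left`), and all three come out as multiples of the same constant
`K = (2N+a+b+1) ‖p‖²`. Hence `w̃_j = K λ̃_j²`, `(β+1) ŵ_1 = K λ̂_1²` and `(α+1) ŵ_2 = K λ̂_2²`,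
which gives positivity. The Gamma-function values of `‖p‖²` and of the leading coefficient turn
`1/√K` into `(-1)^n C_n^{(a,b)}` (`jacobiC_eq`), and the signs of the barycentric weights follow
from the order of the nodes.
-/

noncomputable section

open Polynomial

/-! ### Integration against the Jacobi weight -/

lemma intervalIntegrable_jacobiWeight {a b : ℝ} (ha : -1 < a) (hb : -1 < b) :
    IntervalIntegrable (jacobiWeight a b) MeasureTheory.volume (-1) 1 := by
  have h1 : IntervalIntegrable (fun t : ℝ => (1 + t) ^ b) MeasureTheory.volume (-1) 0 := by
    have := (intervalIntegral.intervalIntegrable_rpow' (a := 0) (b := 1) hb).comp_add_left 1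
    simpa using this
  have h2 : IntervalIntegrable (fun t : ℝ => (1 - t) ^ a) MeasureTheory.volume 0 1 := by
    have := (intervalIntegral.intervalIntegrable_rpow' (a := 1) (b := 0) ha).comp_sub_left 1
    simpa using this
  have h3 : IntervalIntegrable (jacobiWeight a b) MeasureTheory.volume (-1) 0 := by
    refine h1.continuousOn_mul (f := fun t : ℝ => (1 + t) ^ b) (g := fun t : ℝ => (1 - t) ^ a) ?_
    intro t ht
    rw [Set.uIcc_of_le (by norm_num)] at ht
    exact ((continuousAt_const.sub continuousAt_id).rpow_const
      (Or.inl (by linarith [ht.2] : (0 : ℝ) < 1 - t).ne')).continuousWithinAt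
  have h4 : IntervalIntegrable (jacobiWeight a b) MeasureTheory.volume 0 1 := by
    refine h2.mul_continuousOn (f := fun t : ℝ => (1 - t) ^ a) (g := fun t : ℝ => (1 + t) ^ b) ?_
    intro t ht
    rw [Set.uIcc_of_le (by norm_num)] at ht
    exact ((continuousAt_const.add continuousAt_id).rpow_const
      (Or.inl (by linarith [ht.1] : (0 : ℝ) < 1 + t).ne')).continuousWithinAt
  exact h3.trans h4

lemma intervalIntegrable_jacobiWeight_mul_eval {a b : ℝ} (ha : -1 < a) (hb : -1 < b) (p : ℝ[X]) :
    IntervalIntegrable (fun t => jacobiWeight a b t * p.eval t) MeasureTheory.volume (-1) 1 :=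
  (intervalIntegrable_jacobiWeight ha hb).mul_continuousOn p.continuous.continuousOn

/-- The moment functional `p ↦ ∫_{-1}^1 (1-t)^a (1+t)^b p(t) dt` on polynomials. The exponent
bounds are arguments because additivity needs the integrals to converge. -/
def jacobiIntegral {a b : ℝ} (ha : -1 < a) (hb : -1 < b) : ℝ[X] →ₗ[ℝ] ℝ where
  toFun p := ∫ t in (-1 : ℝ)..1, jacobiWeight a b t * p.eval t
  map_add' p q := by
    simp only [eval_add, mul_add]
    exact intervalIntegral.integral_add (intervalIntegrable_jacobiWeight_mul_eval ha hb p)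
      (intervalIntegrable_jacobiWeight_mul_eval ha hb q)
  map_smul' c p := by
    simp only [eval_smul, smul_eq_mul, RingHom.id_apply, mul_left_comm _ c]
    exact intervalIntegral.integral_const_mul _ _

lemma jacobiIntegral_apply {a b : ℝ} (ha : -1 < a) (hb : -1 < b) (p : ℝ[X]) :
    jacobiIntegral ha hb p = ∫ t in (-1 : ℝ)..1, jacobiWeight a b t * p.eval t := rfl

lemma jacobiIntegral_C_mul {a b : ℝ} (ha : -1 < a) (hb : -1 < b) (c : ℝ) (p : ℝ[X]) :
    jacobiIntegral ha hb (C c * p) = c * jacobiIntegral ha hb p := by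
  rw [← smul_eq_C_mul, map_smul, smul_eq_mul]

/-- The endpoints, where `0 ^ 0 = 1` may break the identity `x ^ (a + 1) = x ^ a * x`, form a
null set, so it suffices to compare the integrands on the open interval. -/
lemma jacobiIntegral_congr {a b a' b' : ℝ} (ha : -1 < a) (hb : -1 < b) (ha' : -1 < a')
    (hb' : -1 < b') {p q : ℝ[X]}
    (h : ∀ t ∈ Set.Ioo (-1 : ℝ) 1, jacobiWeight a b t * p.eval t = jacobiWeight a' b' t * q.eval t) :
    jacobiIntegral ha hb p = jacobiIntegral ha' hb' q := by
  rw [jacobiIntegral_apply, jacobiIntegral_apply, intervalIntegral.integral_of_le (by norm_num),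
    intervalIntegral.integral_of_le (by norm_num), MeasureTheory.integral_Ioc_eq_integral_Ioo,
    MeasureTheory.integral_Ioc_eq_integral_Ioo]
  exact MeasureTheory.setIntegral_congr_fun measurableSet_Ioo h

lemma jacobiIntegral_add_one_left {a b : ℝ} (ha : -1 < a) (hb : -1 < b) (ha' : -1 < a + 1)
    (p : ℝ[X]) : jacobiIntegral ha' hb p = jacobiIntegral ha hb ((1 - X) * p) := by
  refine jacobiIntegral_congr _ _ _ _ fun t ht => ?_
  simp only [jacobiWeight, eval_mul, eval_sub, eval_one, eval_X]
  rw [Real.rpow_add_one (by linarith [ht.2])]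
  ring

lemma jacobiIntegral_add_one_right {a b : ℝ} (ha : -1 < a) (hb : -1 < b) (hb' : -1 < b + 1)
    (p : ℝ[X]) : jacobiIntegral ha hb' p = jacobiIntegral ha hb ((1 + X) * p) := by
  refine jacobiIntegral_congr _ _ _ _ fun t ht => ?_
  simp only [jacobiWeight, eval_mul, eval_add, eval_one, eval_X]
  rw [Real.rpow_add_one (by linarith [ht.1])]
  ring

lemma jacobiIntegral_add_one_add_one {a b : ℝ} (ha : -1 < a) (hb : -1 < b) (ha' : -1 < a + 1)
    (hb' : -1 < b + 1) (p : ℝ[X]) :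
    jacobiIntegral ha' hb' p = jacobiIntegral ha hb ((1 - X ^ 2) * p) := by
  rw [jacobiIntegral_add_one_left ha hb', jacobiIntegral_add_one_right ha hb]
  congr 1
  ring

lemma jacobiIntegral_one {a b : ℝ} (ha : -1 < a) (hb : -1 < b) :
    jacobiIntegral ha hb 1 =
      2 ^ (a + b + 1) * (Real.Gamma (a + 1) * Real.Gamma (b + 1) / Real.Gamma (a + b + 2)) := by
  have h1 : Real.Gamma (a + 1) * Real.Gamma (b + 1) / Real.Gamma (a + b + 2) =
      ∫ s in (0 : ℝ)..1, s ^ b * (1 - s) ^ a := by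
    have h := ProbabilityTheory.beta_eq_betaIntegralReal (b + 1) (a + 1) (by linarith)
      (by linarith)
    have h2 : Complex.betaIntegral ((b + 1 : ℝ) : ℂ) ((a + 1 : ℝ) : ℂ) =
        ((∫ s in (0 : ℝ)..1, s ^ b * (1 - s) ^ a : ℝ) : ℂ) := by
      rw [Complex.betaIntegral, ← intervalIntegral.integral_ofReal]
      refine intervalIntegral.integral_congr fun s hs => ?_
      rw [Set.uIcc_of_le (by norm_num)] at hs
      rw [Complex.ofReal_mul, Complex.ofReal_cpow hs.1, Complex.ofReal_cpow (by linarith [hs.2])]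
      push_cast
      ring_nf
    rw [h2, Complex.ofReal_re] at h
    rw [← h, ProbabilityTheory.beta]
    ring_nf
  have h2 : ∫ s in (0 : ℝ)..1, jacobiWeight a b (2 * s - 1) =
      2 ^ (a + b) * ∫ s in (0 : ℝ)..1, s ^ b * (1 - s) ^ a := by
    rw [← intervalIntegral.integral_const_mul]
    refine intervalIntegral.integral_congr fun s hs => ?_
    rw [Set.uIcc_of_le (by norm_num)] at hs
    simp only [jacobiWeight]
    rw [show 1 - (2 * s - 1) = 2 * (1 - s) by ring, show 1 + (2 * s - 1) = 2 * s by ring,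
      Real.mul_rpow (by norm_num) (by linarith [hs.2]), Real.mul_rpow (by norm_num) hs.1,
      Real.rpow_add (by norm_num)]
    ring
  rw [intervalIntegral.integral_comp_mul_sub _ two_ne_zero, smul_eq_mul] at h2
  rw [jacobiIntegral_apply, h1, Real.rpow_add_one two_ne_zero]
  norm_num at h2 ⊢
  linarith

/-- The derivative of `(1-t)^(a+1) (1+t)^(b+1) q(t)` is the weight `(1-t)^a (1+t)^b` times a
polynomial. -/
lemma hasDerivAt_jacobiWeight_mul_eval (a b : ℝ) (q : ℝ[X]) {t : ℝ}
    (ht : t ∈ Set.Ioo (-1 : ℝ) 1) :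
    HasDerivAt (fun t => jacobiWeight (a + 1) (b + 1) t * q.eval t)
      (jacobiWeight a b t *
        ((C (b - a) - C (a + b + 2) * X) * q + (1 - X ^ 2) * derivative q).eval t) t := by
  have h1 : (1 : ℝ) - t ≠ 0 := by linarith [ht.2]
  have h2 : (1 : ℝ) + t ≠ 0 := by linarith [ht.1]
  have e1 := ((hasDerivAt_id t).const_sub 1).rpow_const (p := a + 1) (Or.inl h1)
  have e2 := ((hasDerivAt_id t).const_add 1).rpow_const (p := b + 1) (Or.inl h2)
  have e3 := (e1.mul e2).mul (q.hasDerivAt t)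
  refine e3.congr_deriv ?_
  simp only [jacobiWeight, id, add_sub_cancel_right, eval_add, eval_mul, eval_sub, eval_C, eval_X,
    eval_one, eval_pow, Pi.mul_apply]
  rw [Real.rpow_add_one h1, Real.rpow_add_one h2]
  ring

lemma continuous_jacobiWeight_add_one {a b : ℝ} (ha : -1 < a) (hb : -1 < b) :
    Continuous (jacobiWeight (a + 1) (b + 1)) :=
  ((continuous_const.sub continuous_id).rpow_const fun _ => Or.inr (by linarith)).mul
    ((continuous_const.add continuous_id).rpow_const fun _ => Or.inr (by linarith))

lemma jacobiWeight_add_one_neg_one {a b : ℝ} (hb : -1 < b) :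
    jacobiWeight (a + 1) (b + 1) (-1) = 0 := by
  simp [jacobiWeight, Real.zero_rpow (by linarith : b + 1 ≠ 0)]

lemma jacobiWeight_add_one_one {a b : ℝ} (ha : -1 < a) : jacobiWeight (a + 1) (b + 1) 1 = 0 := by
  simp [jacobiWeight, Real.zero_rpow (by linarith : a + 1 ≠ 0)]

/-- Integration by parts: `(1-t)^(a+1) (1+t)^(b+1) q(t)` vanishes at `±1`, so the integral of its
derivative is zero. -/
lemma jacobiIntegral_derivative_eq_zero {a b : ℝ} (ha : -1 < a) (hb : -1 < b) (q : ℝ[X]) :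
    jacobiIntegral ha hb
      ((C (b - a) - C (a + b + 2) * X) * q + (1 - X ^ 2) * derivative q) = 0 := by
  rw [jacobiIntegral_apply, intervalIntegral.integral_eq_sub_of_hasDerivAt_of_le (by norm_num)
    ((continuous_jacobiWeight_add_one ha hb).mul q.continuous).continuousOn
    (fun t ht => hasDerivAt_jacobiWeight_mul_eval a b q ht)
    (intervalIntegrable_jacobiWeight_mul_eval ha hb _)]
  simp [jacobiWeight_add_one_neg_one hb, jacobiWeight_add_one_one ha]

/-! ### Generalized binomial coefficients -/

lemma Ring.succ_mul_choose_succ (x : ℝ) (k : ℕ) :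
    ((k : ℝ) + 1) * Ring.choose x (k + 1) = (x - k) * Ring.choose x k := by
  have hk : ((k : ℝ) + 1) ≠ 0 := by positivity
  have hf : (k.factorial : ℝ) ≠ 0 := by positivity
  rw [Ring.choose_eq_smul, Ring.choose_eq_smul, descPochhammer_succ_right, smeval_mul, smeval_sub,
    smeval_X, smeval_natCast, Nat.factorial_succ]
  simp only [smul_eq_mul, pow_one, pow_zero, nsmul_eq_mul, mul_one]
  push_cast
  field_simp

lemma Ring.choose_mul_factorial_mul_Gamma {x : ℝ} {k : ℕ} (h : (k : ℝ) < x + 1) :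
    Ring.choose x k * (k.factorial * Real.Gamma (x - k + 1)) = Real.Gamma (x + 1) := by
  induction k with
  | zero => simp
  | succ k ih =>
    push_cast at h
    have hx : x - k ≠ 0 := by linarith
    rw [← ih (by linarith), Real.Gamma_add_one hx, Nat.factorial_succ]
    push_cast
    rw [show x - (k + 1) + 1 = x - k by ring]
    linear_combination (k.factorial * Real.Gamma (x - k)) * Ring.succ_mul_choose_succ x k

/-! ### Raising relation, leading coefficient and orthogonality of Jacobi polynomials -/

/-- With `u = (X-1)/2` and `v = (X+1)/2`, the operator of `jacobiPoly_raising` sends `u^s v^m` to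
`-2 ((a+1+s) u^s v^(m+1) + (b+1+m) u^(s+1) v^m)`. -/
lemma jacobi_term_identity (a b c : ℝ) {s m : ℕ} :
    (C (b - a) - C (a + b + 2) * X) *
        (C c * (C (1 / 2) * (X - 1)) ^ s * (C (1 / 2) * (X + 1)) ^ m) +
      (1 - X ^ 2) * derivative (C c * (C (1 / 2) * (X - 1)) ^ s * (C (1 / 2) * (X + 1)) ^ m) =
    C (-2 : ℝ) * (C ((a + 1 + s) * c) * (C (1 / 2) * (X - 1)) ^ s * (C (1 / 2) * (X + 1)) ^ (m + 1)
      + C ((b + 1 + m) * c) * (C (1 / 2) * (X - 1)) ^ (s + 1) * (C (1 / 2) * (X + 1)) ^ m) := by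
  have hder : ∀ (w : ℝ[X]) (k : ℕ), derivative w = C (1 / 2) →
      w * derivative (w ^ k) = C ((k : ℝ) / 2) * w ^ k := by
    intro w k hw
    rw [derivative_pow, hw]
    cases k with
    | zero => simp
    | succ k =>
      rw [div_eq_mul_one_div ((k + 1 : ℕ) : ℝ), C_mul (a := ((k + 1 : ℕ) : ℝ)),
        Nat.add_sub_cancel, pow_succ]
      ring
  have hu := hder (C (1 / 2) * (X - 1)) s (by simp)
  have hv := hder (C (1 / 2) * (X + 1)) m (by simp)
  have e1 : (1 - X ^ 2 : ℝ[X]) = C (-4 : ℝ) * ((C (1 / 2) * (X - 1)) * (C (1 / 2) * (X + 1))) := by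
    have : (C (-4 : ℝ) * (C (1 / 2) * C (1 / 2)) : ℝ[X]) = -1 := by
      rw [← C_mul, ← C_mul]; norm_num
    linear_combination (-(X - 1) * (X + 1)) * this
  have e2 : (C (b - a) - C (a + b + 2) * X : ℝ[X]) = C (-2 : ℝ) *
      (C (a + 1) * (C (1 / 2) * (X + 1)) + C (b + 1) * (C (1 / 2) * (X - 1))) := by
    have : (C (-2 : ℝ) * C (1 / 2) : ℝ[X]) = -1 := by
      rw [← C_mul]; norm_num
    simp only [C_add, C_sub, C_1, show (2 : ℝ) = 1 + 1 by norm_num] at this ⊢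
    linear_combination (-(C a + 1) * (X + 1) - (C b + 1) * (X - 1)) * this
  rw [e1, e2]
  generalize (C (1 / 2) * (X - 1) : ℝ[X]) = u at *
  generalize (C (1 / 2) * (X + 1) : ℝ[X]) = v at *
  rw [derivative_mul, derivative_mul, derivative_C]
  have c1 : (C ((s : ℝ) / 2) * C (-4) : ℝ[X]) = C (-2) * C (s : ℝ) := by
    rw [← C_mul, ← C_mul]; congr 1; ring
  have c2 : (C ((m : ℝ) / 2) * C (-4) : ℝ[X]) = C (-2) * C (m : ℝ) := by
    rw [← C_mul, ← C_mul]; congr 1; ring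
  simp only [C_mul, C_add]
  linear_combination (C (-4) * v * C c * v ^ m) * hu + (C (-4) * u * C c * u ^ s) * hv +
    (C c * u ^ s * v ^ m * v) * c1 + (C c * u ^ s * v ^ m * u) * c2

/-- The raising relation
`d/dt [(1-t)^(a+1) (1+t)^(b+1) P_N^{(a+1,b+1)}] = -2(N+1) (1-t)^a (1+t)^b P_{N+1}^{(a,b)}`, with the
common weight cancelled. -/
lemma jacobiPoly_raising (N : ℕ) (a b : ℝ) :
    (C (b - a) - C (a + b + 2) * X) * jacobiPoly N (a + 1) (b + 1) +
      (1 - X ^ 2) * derivative (jacobiPoly N (a + 1) (b + 1)) =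
    C (-2 * ((N : ℝ) + 1)) * jacobiPoly (N + 1) a b := by
  simp only [jacobiPoly]
  rw [derivative_sum, Finset.mul_sum, Finset.mul_sum, ← Finset.sum_add_distrib]
  simp only [jacobi_term_identity]
  set u : ℝ[X] := C (1 / 2) * (X - 1)
  set v : ℝ[X] := C (1 / 2) * (X + 1)
  set c : ℕ → ℝ := fun s => Ring.choose (((N + 1 : ℕ) : ℝ) + a) (N + 1 - s) *
    Ring.choose (((N + 1 : ℕ) : ℝ) + b) s with hc
  -- The two families of monomials are the two halves of `N + 1 = (N + 1 - s) + s`.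
  have hF : ∀ s ∈ Finset.range (N + 1), (a + 1 + s) *
      (Ring.choose ((N : ℝ) + (a + 1)) (N - s) * Ring.choose ((N : ℝ) + (b + 1)) s) =
      ((N : ℝ) + 1 - s) * c s := by
    intro s hs
    have hs' : s ≤ N := by simpa [Nat.lt_succ_iff] using hs
    have h := Ring.succ_mul_choose_succ ((N : ℝ) + (a + 1)) (N - s)
    rw [Nat.cast_sub hs'] at h
    have e1 : ((N + 1 : ℕ) : ℝ) + a = N + (a + 1) := by push_cast; ring
    have e2 : ((N + 1 : ℕ) : ℝ) + b = N + (b + 1) := by push_cast; ring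
    simp only [hc]
    rw [e1, e2, Nat.sub_add_comm hs']
    linear_combination (-Ring.choose ((N : ℝ) + (b + 1)) s) * h
  have hG : ∀ s ∈ Finset.range (N + 1), (b + 1 + (N - s : ℕ)) *
      (Ring.choose ((N : ℝ) + (a + 1)) (N - s) * Ring.choose ((N : ℝ) + (b + 1)) s) =
      ((s + 1 : ℕ) : ℝ) * c (s + 1) := by
    intro s hs
    have hs' : s ≤ N := by simpa [Nat.lt_succ_iff] using hs
    have h := Ring.succ_mul_choose_succ ((N : ℝ) + (b + 1)) s
    have e1 : ((N + 1 : ℕ) : ℝ) + a = N + (a + 1) := by push_cast; ring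
    have e2 : ((N + 1 : ℕ) : ℝ) + b = N + (b + 1) := by push_cast; ring
    simp only [hc]
    rw [e1, e2, Nat.add_sub_add_right, Nat.cast_sub hs']
    push_cast
    linear_combination (-Ring.choose ((N : ℝ) + (a + 1)) (N - s)) * h
  have h1 : ∑ s ∈ Finset.range (N + 1), C ((a + 1 + s) *
      (Ring.choose ((N : ℝ) + (a + 1)) (N - s) * Ring.choose ((N : ℝ) + (b + 1)) s)) * u ^ s *
      v ^ (N - s + 1) =
      ∑ s ∈ Finset.range (N + 1 + 1), C (((N : ℝ) + 1 - s) * c s) * u ^ s * v ^ (N + 1 - s) := by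
    rw [Finset.sum_range_succ _ (N + 1)]
    have : ((N : ℝ) + 1 - (N + 1 : ℕ)) = 0 := by push_cast; ring
    rw [this, zero_mul, C_0, zero_mul, zero_mul, add_zero]
    refine Finset.sum_congr rfl fun s hs => ?_
    rw [hF s hs, Nat.sub_add_comm (by simpa [Nat.lt_succ_iff] using hs)]
  have h2 : ∑ s ∈ Finset.range (N + 1), C ((b + 1 + (N - s : ℕ)) *
      (Ring.choose ((N : ℝ) + (a + 1)) (N - s) * Ring.choose ((N : ℝ) + (b + 1)) s)) * u ^ (s + 1) *
      v ^ (N - s) =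
      ∑ s ∈ Finset.range (N + 1 + 1), C ((s : ℝ) * c s) * u ^ s * v ^ (N + 1 - s) := by
    rw [Finset.sum_range_succ' _ (N + 1)]
    rw [Nat.cast_zero, zero_mul, C_0, zero_mul, zero_mul, add_zero]
    refine Finset.sum_congr rfl fun s hs => ?_
    rw [hG s hs, Nat.add_sub_add_right]
  rw [← Finset.mul_sum, Finset.sum_add_distrib, h1, h2, ← Finset.sum_add_distrib, C_mul, mul_assoc,
    Finset.mul_sum (a := (C ((N : ℝ) + 1)))]
  congr 1
  refine Finset.sum_congr rfl fun s _ => ?_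
  change _ = C ((N : ℝ) + 1) * (C (c s) * u ^ s * v ^ (N + 1 - s))
  simp only [C_mul, C_sub, C_add]
  ring

lemma natDegree_affine_le (r : ℝ) : (C (1 / 2) * (X + C r) : ℝ[X]).natDegree ≤ 1 :=
  (natDegree_C_mul_le _ _).trans (natDegree_X_add_C r).le

lemma natDegree_jacobiPoly_le (N : ℕ) (a b : ℝ) : (jacobiPoly N a b).natDegree ≤ N := by
  refine natDegree_sum_le_of_forall_le _ _ fun s hs => ?_
  have hs' : s ≤ N := by simpa [Nat.lt_succ_iff] using hs
  have h1 := natDegree_pow_le_of_le s (natDegree_affine_le (-1))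
  have h2 := natDegree_pow_le_of_le (N - s) (natDegree_affine_le 1)
  simp only [C_neg, C_1, ← sub_eq_add_neg] at h1 h2
  refine (natDegree_mul_le_of_le ((natDegree_C_mul_le _ _).trans h1) h2).trans ?_
  omega

/-- By the Chu–Vandermonde identity. -/
lemma coeff_jacobiPoly (N : ℕ) (a b : ℝ) :
    (jacobiPoly N a b).coeff N = (1 / 2) ^ N * Ring.choose (2 * (N : ℝ) + a + b) N := by
  rw [show 2 * (N : ℝ) + a + b = (N + b) + (N + a) by ring,
    Ring.add_choose_eq N (Commute.all _ _),
    Finset.Nat.sum_antidiagonal_eq_sum_range_succ_mk, jacobiPoly, finsetSum_coeff, Finset.mul_sum]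
  refine Finset.sum_congr rfl fun s hs => ?_
  have hs' : s ≤ N := by simpa [Nat.lt_succ_iff] using hs
  have h1 := coeff_pow_of_natDegree_le (m := s) (natDegree_affine_le (-1))
  have h2 := coeff_pow_of_natDegree_le (m := N - s) (natDegree_affine_le 1)
  have d1 := natDegree_pow_le_of_le s (natDegree_affine_le (-1))
  have d2 := natDegree_pow_le_of_le (N - s) (natDegree_affine_le 1)
  have h3 := coeff_mul_add_eq_of_natDegree_le d1 d2
  rw [mul_one, mul_one, Nat.add_sub_cancel' hs'] at h3
  rw [mul_one] at h1 h2
  rw [h1, h2] at h3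
  simp only [C_neg, C_1, ← sub_eq_add_neg] at h3
  rw [mul_assoc, coeff_C_mul, h3]
  simp only [coeff_C_mul, coeff_sub, coeff_add, coeff_X_one, coeff_one]
  norm_num
  rw [mul_assoc, ← pow_add, Nat.add_sub_cancel' hs']
  ring

/-- Orthogonality together with the normalization: against a polynomial of degree at most `N`, the
functional `q ↦ ∫ (1-t)^a (1+t)^b P_N q` only sees the coefficient of `X^N`. -/
lemma jacobiIntegral_jacobiPoly_mul (N : ℕ) {a b : ℝ} (ha : -1 < a) (hb : -1 < b) {q : ℝ[X]}
    (hq : q.natDegree ≤ N) :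
    jacobiIntegral ha hb (jacobiPoly N a b * q) = q.coeff N *
      (2 ^ (a + b + N + 1) * (Real.Gamma (a + N + 1) * Real.Gamma (b + N + 1) /
        Real.Gamma (a + b + 2 * N + 2))) := by
  induction N generalizing a b q with
  | zero =>
    rw [eq_C_of_natDegree_le_zero hq, mul_comm, jacobiIntegral_C_mul]
    have h := jacobiIntegral_one ha hb
    simpa [jacobiPoly] using Or.inl h
  | succ N ih =>
    have ha' : -1 < a + 1 := by linarith
    have hb' : -1 < b + 1 := by linarith
    have h := jacobiIntegral_derivative_eq_zero ha hb (jacobiPoly N (a + 1) (b + 1) * q)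
    have hpoly : (C (b - a) - C (a + b + 2) * X) * (jacobiPoly N (a + 1) (b + 1) * q) +
        (1 - X ^ 2) * derivative (jacobiPoly N (a + 1) (b + 1) * q) =
        C (-2 * ((N : ℝ) + 1)) * (jacobiPoly (N + 1) a b * q) +
        (1 - X ^ 2) * (jacobiPoly N (a + 1) (b + 1) * derivative q) := by
      rw [derivative_mul]
      linear_combination q * jacobiPoly_raising N a b
    have hdeg : (derivative q).natDegree ≤ N := (natDegree_derivative_le q).trans (by omega)
    rw [hpoly, map_add, jacobiIntegral_C_mul, ← jacobiIntegral_add_one_add_one ha hb ha' hb',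
      ih ha' hb' hdeg, coeff_derivative] at h
    have hN : ((N : ℝ) + 1) ≠ 0 := by positivity
    have e : (2 : ℝ) ^ (a + 1 + (b + 1) + N + 1) = 2 * 2 ^ (a + b + (N + 1 : ℕ) + 1) := by
      rw [mul_comm, ← Real.rpow_add_one two_ne_zero]
      congr 1
      push_cast
      ring
    rw [e, show a + 1 + N + 1 = a + (N + 1 : ℕ) + 1 by push_cast; ring,
      show b + 1 + N + 1 = b + (N + 1 : ℕ) + 1 by push_cast; ring,
      show a + 1 + (b + 1) + 2 * N + 2 = a + b + 2 * (N + 1 : ℕ) + 2 by push_cast; ring] at h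
    refine mul_left_cancel₀ (mul_ne_zero two_ne_zero hN) ?_
    linear_combination -h

lemma jacobiPoly_coeff_pos {N : ℕ} (hN : N ≠ 0) {a b : ℝ} (ha : -1 < a) (hb : -1 < b) :
    0 < (jacobiPoly N a b).coeff N := by
  have hN1 : (1 : ℝ) ≤ N := by exact_mod_cast Nat.one_le_iff_ne_zero.mpr hN
  have h := Ring.choose_mul_factorial_mul_Gamma (x := 2 * (N : ℝ) + a + b) (k := N) (by linarith)
  have h1 : 0 < Real.Gamma (2 * (N : ℝ) + a + b + 1) := Real.Gamma_pos_of_pos (by linarith)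
  have h2 : 0 < Real.Gamma (2 * (N : ℝ) + a + b - N + 1) := Real.Gamma_pos_of_pos (by linarith)
  have h3 : (0 : ℝ) < N.factorial := by positivity
  rw [← h] at h1
  rw [coeff_jacobiPoly]
  have := pos_of_mul_pos_left h1 (mul_pos h3 h2).le
  positivity

/-! ### Zeros of Jacobi polynomials -/

/-- By induction with Rolle's theorem: `(1-t)^(a+1) (1+t)^(b+1) P_N^{(a+1,b+1)}(t)` vanishes at `±1`
and at the `N` zeros of `P_N^{(a+1,b+1)}`, and by the raising relation its derivative vanishes in
`(-1,1)` only where `P_{N+1}^{(a,b)}` does. -/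
lemma exists_strictMono_isRoot_jacobiPoly (N : ℕ) {a b : ℝ} (ha : -1 < a) (hb : -1 < b) :
    ∃ x : Fin N → ℝ, StrictMono x ∧
      ∀ i, x i ∈ Set.Ioo (-1 : ℝ) 1 ∧ (jacobiPoly N a b).IsRoot (x i) := by
  induction N generalizing a b with
  | zero => exact ⟨Fin.elim0, fun i => i.elim0, fun i => i.elim0⟩
  | succ N ih =>
    obtain ⟨x, hx, hroot⟩ := ih (a := a + 1) (b := b + 1) (by linarith) (by linarith)
    let y : Fin (N + 2) → ℝ := Fin.cons (-1) (Fin.snoc (α := fun _ => ℝ) x 1)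
    have hmem : ∀ i, x i ∈ Set.Ioo (-1 : ℝ) 1 := fun i => (hroot i).1
    have hy : StrictMono y := by
      refine Fin.strictMono_iff_lt_succ.mpr fun i => ?_
      cases i using Fin.cases with
      | zero =>
        simp only [y, Fin.castSucc_zero, Fin.cons_zero, Fin.cons_succ]
        generalize (0 : Fin (N + 1)) = j
        cases j using Fin.lastCases with
        | last => simp
        | cast j => simpa using (hmem j).1
      | succ i =>
        simp only [y, Fin.castSucc_succ, Fin.cons_succ, Fin.snoc_castSucc]
        rcases Fin.eq_castSucc_or_eq_last i.succ with ⟨j, hj⟩ | hj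
        · rw [hj, Fin.snoc_castSucc]
          refine hx ?_
          have := congrArg Fin.val hj
          simp only [Fin.val_succ, Fin.val_castSucc] at this
          exact Fin.lt_def.mpr (by omega)
        · rw [hj, Fin.snoc_last]
          exact (hmem i).2
    have hcases : ∀ i, y i = -1 ∨ y i = 1 ∨ ∃ j, y i = x j := by
      intro i
      cases i using Fin.cases with
      | zero => exact Or.inl rfl
      | succ i =>
        cases i using Fin.lastCases with
        | last => simp [y]
        | cast j => exact Or.inr (Or.inr ⟨j, by simp [y]⟩)
    have hy0 : ∀ i, y i ∈ Set.Icc (-1 : ℝ) 1 := by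
      intro i
      rcases hcases i with h | h | ⟨j, h⟩ <;> rw [h]
      · norm_num
      · norm_num
      · exact ⟨(hmem j).1.le, (hmem j).2.le⟩
    have hf : ∀ i, jacobiWeight (a + 1) (b + 1) (y i) *
        (jacobiPoly N (a + 1) (b + 1)).eval (y i) = 0 := by
      intro i
      rcases hcases i with h | h | ⟨j, h⟩ <;> rw [h]
      · rw [jacobiWeight_add_one_neg_one hb, zero_mul]
      · rw [jacobiWeight_add_one_one ha, zero_mul]
      · rw [(hroot j).2, mul_zero]
    have hrolle : ∀ i : Fin (N + 1), ∃ z ∈ Set.Ioo (y i.castSucc) (y i.succ),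
        (jacobiPoly (N + 1) a b).IsRoot z := by
      intro i
      have hsub : Set.Icc (y i.castSucc) (y i.succ) ⊆ Set.Icc (-1) 1 :=
        Set.Icc_subset_Icc (hy0 _).1 (hy0 _).2
      have hsub' : ∀ t ∈ Set.Ioo (y i.castSucc) (y i.succ), t ∈ Set.Ioo (-1 : ℝ) 1 :=
        fun t ht => ⟨(hy0 _).1.trans_lt ht.1, ht.2.trans_le (hy0 _).2⟩
      obtain ⟨z, hz, hz0⟩ := exists_hasDerivAt_eq_zero (hy i.castSucc_lt_succ)
        ((continuous_jacobiWeight_add_one ha hb).mul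
          (jacobiPoly N (a + 1) (b + 1)).continuous).continuousOn
        ((hf _).trans (hf _).symm)
        fun t ht => hasDerivAt_jacobiWeight_mul_eval a b (jacobiPoly N (a + 1) (b + 1)) (hsub' t ht)
      refine ⟨z, hz, ?_⟩
      obtain ⟨hz1, hz2⟩ := hsub' z hz
      have hw : jacobiWeight a b z ≠ 0 :=
        (mul_pos (Real.rpow_pos_of_pos (by linarith) _) (Real.rpow_pos_of_pos (by linarith) _)).ne'
      rw [jacobiPoly_raising, eval_mul, eval_C] at hz0
      have hN : (-2 * ((N : ℝ) + 1)) ≠ 0 := mul_ne_zero (by norm_num) (by positivity)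
      exact (mul_eq_zero.mp ((mul_eq_zero.mp hz0).resolve_left hw)).resolve_left hN
    choose z hz hz0 using hrolle
    refine ⟨z, Fin.strictMono_iff_lt_succ.mpr fun i => ?_, fun i => ⟨⟨?_, ?_⟩, hz0 i⟩⟩
    · exact (hz i.castSucc).2.trans (hz i.succ).1
    · exact (hy0 _).1.trans_lt (hz i).1
    · exact (hz i).2.trans_le (hy0 _).2

lemma natDegree_sub_le_of_degree_le {p q : ℝ[X]} {n : ℕ} (hp : p.natDegree ≤ n)
    (hq : q.natDegree ≤ n) : (p - q).natDegree ≤ n :=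
  (natDegree_sub_le_of_le hp hq).trans (max_self n).le

lemma jacobiPoly_eq_C_mul_nodal {N : ℕ} {a b : ℝ} {x : Fin N → ℝ} (hx : StrictMono x)
    (hroot : ∀ i, (jacobiPoly N a b).IsRoot (x i)) :
    jacobiPoly N a b = C ((jacobiPoly N a b).coeff N) * Lagrange.nodal Finset.univ x := by
  have hdeg : (Lagrange.nodal Finset.univ x).natDegree = N := by simp [Lagrange.natDegree_nodal]
  have hlead : (Lagrange.nodal Finset.univ x).coeff N = 1 := by
    have := (Lagrange.nodal_monic (s := Finset.univ) (v := x)).coeff_natDegree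
    rwa [hdeg] at this
  rw [← sub_eq_zero]
  refine eq_zero_of_degree_lt_of_eval_index_eq_zero Finset.univ
    (v := x) hx.injective.injOn ?_ fun i hi => ?_
  · rw [Finset.card_univ, Fintype.card_fin, degree_lt_iff_coeff_zero]
    intro m hm
    rcases hm.eq_or_lt with rfl | hm
    · rw [coeff_sub, coeff_C_mul, hlead, mul_one, sub_self]
    · refine coeff_eq_zero_of_natDegree_lt (lt_of_le_of_lt ?_ hm)
      exact natDegree_sub_le_of_degree_le (natDegree_jacobiPoly_le N a b)
        ((natDegree_C_mul_le _ _).trans hdeg.le)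
  · rw [eval_sub, hroot i, eval_mul, Lagrange.eval_nodal_at_node hi]
    simp

lemma range_eq_setOf_isRoot_jacobiPoly {N : ℕ} (hN : N ≠ 0) {a b : ℝ} (ha : -1 < a) (hb : -1 < b)
    {x : Fin N → ℝ} (hx : StrictMono x) (hroot : ∀ i, (jacobiPoly N a b).IsRoot (x i)) :
    Set.range x = {t : ℝ | (jacobiPoly N a b).IsRoot t} := by
  refine Set.Subset.antisymm (Set.range_subset_iff.mpr hroot) fun t ht => ?_
  rw [Set.mem_ofPred_eq, IsRoot, jacobiPoly_eq_C_mul_nodal hx hroot, eval_mul, eval_C,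
    Lagrange.eval_nodal] at ht
  obtain ⟨i, -, hi⟩ := Finset.prod_eq_zero_iff.mp
    ((mul_eq_zero.mp ht).resolve_left (jacobiPoly_coeff_pos hN ha hb).ne')
  exact ⟨i, (sub_eq_zero.mp hi).symm⟩

lemma mem_Ioo_of_isRoot_jacobiPoly {N : ℕ} (hN : N ≠ 0) {a b : ℝ} (ha : -1 < a) (hb : -1 < b)
    {t : ℝ} (ht : (jacobiPoly N a b).IsRoot t) : t ∈ Set.Ioo (-1 : ℝ) 1 := by
  obtain ⟨x, hx, hroot⟩ := exists_strictMono_isRoot_jacobiPoly N ha hb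
  have ht' : t ∈ Set.range x := by
    rw [range_eq_setOf_isRoot_jacobiPoly hN ha hb hx fun i => (hroot i).2]
    exact ht
  obtain ⟨i, rfl⟩ := ht'
  exact (hroot i).1

/-! ### Norm identities for monic orthogonal polynomials -/

lemma coeff_X_mul_derivative (p : ℝ[X]) (m : ℕ) :
    (X * derivative p).coeff m = m * p.coeff m := by
  cases m with
  | zero => simp
  | succ m => rw [coeff_X_mul, coeff_derivative]; push_cast; ring

lemma natDegree_X_mul_derivative_le (p : ℝ[X]) : (X * derivative p).natDegree ≤ p.natDegree := by
  refine natDegree_le_iff_coeff_eq_zero.mpr fun m hm => ?_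
  rw [coeff_X_mul_derivative, coeff_eq_zero_of_natDegree_lt hm, mul_zero]

/-- Integrate the derivative of `(1-t)^(a+1) (1+t)^(b+1) ℓ(t) p(t)`, where `p = (X - c) ℓ`: up to
the term `(1 - c²) ℓ²`, its polynomial part is `p` times a polynomial of degree at most `deg p`, on
which orthogonality applies. -/
lemma one_sub_sq_mul_jacobiIntegral_sq {a b : ℝ} (ha : -1 < a) (hb : -1 < b) {m : ℕ} {c h : ℝ}
    {p l : ℝ[X]} (hl : l.Monic) (hlm : l.natDegree = m) (hp : p = (X - C c) * l)
    (horth : ∀ q : ℝ[X], q.natDegree ≤ m + 1 → jacobiIntegral ha hb (p * q) = q.coeff (m + 1) * h) :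
    (1 - c ^ 2) * jacobiIntegral ha hb (l ^ 2) = (a + b + 2 * m + 3) * h := by
  set R : ℝ[X] := C (b - a - c) * l - C (a + b + 3) * (X * l) + C 2 * derivative l -
    C 2 * (X * (X * derivative l)) with hR
  have hzero := jacobiIntegral_derivative_eq_zero ha hb (l * p)
  have hpoly : (C (b - a) - C (a + b + 2) * X) * (l * p) + (1 - X ^ 2) * derivative (l * p) =
      p * R + C (1 - c ^ 2) * l ^ 2 := by
    have hder : derivative p = l + (X - C c) * derivative l := by
      rw [hp, derivative_mul, derivative_sub, derivative_X, derivative_C]; ring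
    have h3 : (C (a + b + 3) : ℝ[X]) = C (a + b + 2) + 1 := by rw [← C_1, ← C_add]; congr 1; ring
    have h2 : (C 2 : ℝ[X]) = 1 + 1 := by rw [← C_1, ← C_add]; congr 1; norm_num
    rw [derivative_mul, hder, hR, h3, h2, hp]
    simp only [C_sub, C_pow, C_1]
    ring
  have hlc : l.coeff m = 1 := by rw [← hlm]; exact hl
  have hl0 : l.coeff (m + 1) = 0 := coeff_eq_zero_of_natDegree_lt (by omega)
  have hcoeff : R.coeff (m + 1) = -(a + b + 2 * m + 3) := by
    simp only [hR, coeff_sub, coeff_add, coeff_C_mul, coeff_X_mul, coeff_X_mul_derivative, hlc, hl0,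
      coeff_derivative, coeff_eq_zero_of_natDegree_lt (show l.natDegree < m + 1 + 1 by omega)]
    ring
  have hX : ∀ q : ℝ[X], q.natDegree ≤ m → (X * q).natDegree ≤ m + 1 := fun q hq =>
    (natDegree_mul_le_of_le natDegree_X_le hq).trans (by omega)
  have hdeg : R.natDegree ≤ m + 1 := by
    refine natDegree_sub_le_of_degree_le (natDegree_add_le_of_degree_le
      (natDegree_sub_le_of_degree_le ?_ ?_) ?_) ?_
      <;> refine (natDegree_C_mul_le _ _).trans ?_
    · omega
    · exact hX _ hlm.le
    · exact (natDegree_derivative_le l).trans (by omega)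
    · exact hX _ ((natDegree_X_mul_derivative_le l).trans hlm.le)
  rw [hpoly, map_add, jacobiIntegral_C_mul, horth R hdeg, hcoeff] at hzero
  linarith

/-- Integrate the derivative of `(1-t)^(a+1) (1+t)^(b+1) p(t)^2`, with `p` orthogonal for the weight
`(1-t)^a (1+t)^(b+1)`. -/
lemma jacobiIntegral_sq_of_orthogonal_right {a b : ℝ} (ha : -1 < a) (hb : -1 < b)
    (hb' : -1 < b + 1) {m : ℕ} {h : ℝ} {p : ℝ[X]} (hp : p.Monic) (hpm : p.natDegree = m)
    (horth : ∀ q : ℝ[X], q.natDegree ≤ m → jacobiIntegral ha hb' (p * q) = q.coeff m * h) :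
    2 * (b + 1) * jacobiIntegral ha hb (p ^ 2) = (a + b + 2 * m + 2) * h := by
  set R : ℝ[X] := C 2 * derivative p - C 2 * (X * derivative p) - C (a + b + 2) * p with hR
  have hzero := jacobiIntegral_derivative_eq_zero ha hb (p ^ 2)
  have hpoly : (C (b - a) - C (a + b + 2) * X) * p ^ 2 + (1 - X ^ 2) * derivative (p ^ 2) =
      (1 + X) * (p * R) + C (2 * (b + 1)) * p ^ 2 := by
    have h2 : (C 2 : ℝ[X]) = 1 + 1 := by rw [← C_1, ← C_add]; congr 1; norm_num
    rw [derivative_pow, hR]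
    simp only [C_mul, C_add, C_sub, h2, C_1, Nat.cast_ofNat, Nat.add_one_sub_one, pow_one]
    ring
  have hpc : p.coeff m = 1 := by rw [← hpm]; exact hp
  have hcoeff : R.coeff m = -(a + b + 2 * m + 2) := by
    simp only [hR, coeff_sub, coeff_C_mul, coeff_X_mul_derivative, hpc, coeff_derivative,
      coeff_eq_zero_of_natDegree_lt (show p.natDegree < m + 1 by omega)]
    ring
  have hdeg : R.natDegree ≤ m := by
    refine natDegree_sub_le_of_degree_le (natDegree_sub_le_of_degree_le ?_ ?_) ?_
      <;> refine (natDegree_C_mul_le _ _).trans ?_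
    · exact (natDegree_derivative_le p).trans (by omega)
    · exact (natDegree_X_mul_derivative_le p).trans hpm.le
    · exact hpm.le
  rw [hpoly, map_add, jacobiIntegral_C_mul, ← jacobiIntegral_add_one_right ha hb hb',
    horth R hdeg, hcoeff] at hzero
  linarith

lemma jacobiIntegral_sq_of_orthogonal_left {a b : ℝ} (ha : -1 < a) (hb : -1 < b)
    (ha' : -1 < a + 1) {m : ℕ} {h : ℝ} {p : ℝ[X]} (hp : p.Monic) (hpm : p.natDegree = m)
    (horth : ∀ q : ℝ[X], q.natDegree ≤ m → jacobiIntegral ha' hb (p * q) = q.coeff m * h) :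
    2 * (a + 1) * jacobiIntegral ha hb (p ^ 2) = (a + b + 2 * m + 2) * h := by
  set R : ℝ[X] := C 2 * derivative p + C 2 * (X * derivative p) + C (a + b + 2) * p with hR
  have hzero := jacobiIntegral_derivative_eq_zero ha hb (p ^ 2)
  have hpoly : (C (b - a) - C (a + b + 2) * X) * p ^ 2 + (1 - X ^ 2) * derivative (p ^ 2) =
      (1 - X) * (p * R) - C (2 * (a + 1)) * p ^ 2 := by
    have h2 : (C 2 : ℝ[X]) = 1 + 1 := by rw [← C_1, ← C_add]; congr 1; norm_num
    rw [derivative_pow, hR]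
    simp only [C_mul, C_add, C_sub, h2, C_1, Nat.cast_ofNat, Nat.add_one_sub_one, pow_one]
    ring
  have hpc : p.coeff m = 1 := by rw [← hpm]; exact hp
  have hcoeff : R.coeff m = a + b + 2 * m + 2 := by
    simp only [hR, coeff_add, coeff_C_mul, coeff_X_mul_derivative, hpc, coeff_derivative,
      coeff_eq_zero_of_natDegree_lt (show p.natDegree < m + 1 by omega)]
    ring
  have hdeg : R.natDegree ≤ m := by
    refine natDegree_add_le_of_degree_le (natDegree_add_le_of_degree_le ?_ ?_) ?_
      <;> refine (natDegree_C_mul_le _ _).trans ?_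
    · exact (natDegree_derivative_le p).trans (by omega)
    · exact (natDegree_X_mul_derivative_le p).trans hpm.le
    · exact hpm.le
  rw [hpoly, map_sub, jacobiIntegral_C_mul, ← jacobiIntegral_add_one_left ha hb ha',
    horth R hdeg, hcoeff] at hzero
  linarith

/-- The value of `∫ (1-t)^a (1+t)^b p(t)^2 dt` for the monic multiple `p` of `P_N^{(a,b)}`. -/
def monicJacobiNormSq (N : ℕ) (a b : ℝ) : ℝ :=
  2 ^ (a + b + N + 1) * (Real.Gamma (a + N + 1) * Real.Gamma (b + N + 1) /
    Real.Gamma (a + b + 2 * N + 2)) / (jacobiPoly N a b).coeff N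

lemma monicJacobiNormSq_pos {N : ℕ} (hN : N ≠ 0) {a b : ℝ} (ha : -1 < a) (hb : -1 < b) :
    0 < monicJacobiNormSq N a b := by
  have hN1 : (0 : ℝ) ≤ N := Nat.cast_nonneg N
  have h1 := jacobiPoly_coeff_pos hN ha hb
  have h2 : 0 < Real.Gamma (a + N + 1) := Real.Gamma_pos_of_pos (by linarith)
  have h3 : 0 < Real.Gamma (b + N + 1) := Real.Gamma_pos_of_pos (by linarith)
  have h4 : 0 < Real.Gamma (a + b + 2 * N + 2) := Real.Gamma_pos_of_pos (by linarith)
  unfold monicJacobiNormSq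
  positivity

lemma jacobiIntegral_nodal_mul {N : ℕ} (hN : N ≠ 0) {a b : ℝ} (ha : -1 < a) (hb : -1 < b)
    {x : Fin N → ℝ} (hx : StrictMono x) (hroot : ∀ i, (jacobiPoly N a b).IsRoot (x i))
    {q : ℝ[X]} (hq : q.natDegree ≤ N) :
    jacobiIntegral ha hb (Lagrange.nodal Finset.univ x * q) =
      q.coeff N * monicJacobiNormSq N a b := by
  have h := jacobiIntegral_jacobiPoly_mul N ha hb hq
  rw [jacobiPoly_eq_C_mul_nodal hx hroot, mul_assoc, jacobiIntegral_C_mul] at h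
  have hk := (jacobiPoly_coeff_pos hN ha hb).ne'
  rw [monicJacobiNormSq, mul_div_assoc', eq_div_iff hk]
  linarith

/-- Up to sign, `C_n^{(a,b)}` is `1/√K` with `K = (2N+a+b+1) ‖p‖²`, `N = n + 1` and `p` the monic
multiple of `P_N^{(a,b)}`. -/
lemma jacobiC_eq (n : ℕ) {a b : ℝ} (ha : -1 < a) (hb : -1 < b) :
    jacobiC n a b = (-1) ^ n / √((a + b + 2 * n + 3) * monicJacobiNormSq (n + 1) a b) := by
  have hn : (0 : ℝ) ≤ n := Nat.cast_nonneg n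
  have g0 : 0 < Real.Gamma (2 * n + a + b + 3) := Real.Gamma_pos_of_pos (by linarith)
  have g1 : 0 < Real.Gamma (n + a + b + 2) := Real.Gamma_pos_of_pos (by linarith)
  have g2 : 0 < Real.Gamma (n + a + 2) := Real.Gamma_pos_of_pos (by linarith)
  have g3 : 0 < Real.Gamma (n + b + 2) := Real.Gamma_pos_of_pos (by linarith)
  have hf : (0 : ℝ) < (n + 1).factorial := by positivity
  have hchoose := Ring.choose_mul_factorial_mul_Gamma
    (x := 2 * ((n + 1 : ℕ) : ℝ) + a + b) (k := n + 1) (by push_cast; linarith)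
  rw [show 2 * ((n + 1 : ℕ) : ℝ) + a + b - (n + 1 : ℕ) + 1 = n + a + b + 2 by push_cast; ring,
    show 2 * ((n + 1 : ℕ) : ℝ) + a + b + 1 = 2 * n + a + b + 3 by push_cast; ring] at hchoose
  have hG : Real.Gamma (a + b + 2 * (n + 1 : ℕ) + 2) =
      (a + b + 2 * n + 3) * Real.Gamma (2 * n + a + b + 3) := by
    rw [show a + b + 2 * ((n + 1 : ℕ) : ℝ) + 2 = (2 * n + a + b + 3) + 1 by push_cast; ring,
      Real.Gamma_add_one (by linarith)]
    ring
  have hE : (0 : ℝ) < 2 ^ ((n : ℝ) + 1 + (a + b + 1) / 2) := by positivity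
  have hpow : (2 : ℝ) ^ (a + b + (n + 1 : ℕ) + 1) * 2 ^ (n + 1) =
      ((2 : ℝ) ^ ((n : ℝ) + 1 + (a + b + 1) / 2)) ^ 2 := by
    rw [← Real.rpow_natCast, ← Real.rpow_add two_pos, ← Real.rpow_natCast,
      ← Real.rpow_mul two_pos.le]
    congr 1
    push_cast
    ring
  have hK : (a + b + 2 * n + 3) * monicJacobiNormSq (n + 1) a b =
      (2 ^ ((n : ℝ) + 1 + (a + b + 1) / 2)) ^ 2 * ((n + 1).factorial * Real.Gamma (n + a + b + 2) *
        Real.Gamma (n + a + 2) * Real.Gamma (n + b + 2)) / Real.Gamma (2 * n + a + b + 3) ^ 2 := by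
    have hne : a + b + 2 * (n : ℝ) + 3 ≠ 0 := by linarith
    have hk : Ring.choose (2 * ((n + 1 : ℕ) : ℝ) + a + b) (n + 1) =
        Real.Gamma (2 * n + a + b + 3) / ((n + 1).factorial * Real.Gamma (n + a + b + 2)) := by
      rw [eq_div_iff (mul_pos hf g1).ne', hchoose]
    rw [monicJacobiNormSq, coeff_jacobiPoly, hk, hG, ← hpow,
      show a + ((n + 1 : ℕ) : ℝ) + 1 = n + a + 2 by push_cast; ring,
      show b + ((n + 1 : ℕ) : ℝ) + 1 = n + b + 2 by push_cast; ring, one_div, inv_pow]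
    field_simp
  have hsign : (if Even n then (1 : ℝ) else -1) = (-1) ^ n := by
    split_ifs with h
    · exact h.neg_one_pow.symm
    · exact (Nat.not_even_iff_odd.mp h).neg_one_pow.symm
  rw [jacobiC, hsign, hK, Real.sqrt_div (by positivity), Real.sqrt_sq g0.le,
    Real.sqrt_mul (sq_nonneg _), Real.sqrt_sq hE.le]
  field_simp

/-! ### Barycentric weights of the Lobatto nodes -/

lemma barycentricWeight_lobattoNodes_inl {n : ℕ} (x : Fin (n + 1) → ℝ) (j : Fin (n + 1)) :
    barycentricWeight (lobattoNodes x) (Sum.inl j) =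
      1 / ((Lagrange.nodal (Finset.univ.erase j) x).eval (x j) * ((x j + 1) * (x j - 1))) := by
  have h : (Finset.univ.erase (Sum.inl j) : Finset (Fin (n + 1) ⊕ Fin 2)) =
      (Finset.univ.erase j).disjSum Finset.univ := by
    ext (i | i) <;> simp
  rw [barycentricWeight, h, Finset.prod_disjSum, Fin.prod_univ_two, Lagrange.eval_nodal]
  simp [lobattoNodes]

lemma barycentricWeight_lobattoNodes_inr_zero {n : ℕ} (x : Fin (n + 1) → ℝ) :
    barycentricWeight (lobattoNodes x) (Sum.inr 0) =
      1 / ((Lagrange.nodal Finset.univ x).eval (-1) * (-2)) := by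
  have h : (Finset.univ.erase (Sum.inr 0) : Finset (Fin (n + 1) ⊕ Fin 2)) =
      Finset.univ.disjSum {1} := by
    ext (i | i)
    · simp
    · fin_cases i <;> simp
  rw [barycentricWeight, h, Finset.prod_disjSum, Lagrange.eval_nodal]
  simp [lobattoNodes]
  norm_num

lemma barycentricWeight_lobattoNodes_inr_one {n : ℕ} (x : Fin (n + 1) → ℝ) :
    barycentricWeight (lobattoNodes x) (Sum.inr 1) =
      1 / ((Lagrange.nodal Finset.univ x).eval 1 * 2) := by
  have h : (Finset.univ.erase (Sum.inr 1) : Finset (Fin (n + 1) ⊕ Fin 2)) =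
      Finset.univ.disjSum {0} := by
    ext (i | i)
    · simp
    · fin_cases i <;> simp
  rw [barycentricWeight, h, Finset.prod_disjSum, Lagrange.eval_nodal]
  simp [lobattoNodes]
  norm_num

lemma eval_nodal_pos {ι : Type*} {s : Finset ι} {v : ι → ℝ} {t : ℝ} (h : ∀ i ∈ s, v i < t) :
    0 < (Lagrange.nodal s v).eval t := by
  rw [Lagrange.eval_nodal]
  exact Finset.prod_pos fun i hi => sub_pos.mpr (h i hi)

lemma neg_one_pow_mul_eval_nodal_pos {ι : Type*} {s : Finset ι} {v : ι → ℝ} {t : ℝ}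
    (h : ∀ i ∈ s, t < v i) : 0 < (-1) ^ s.card * (Lagrange.nodal s v).eval t := by
  rw [Lagrange.eval_nodal, ← Finset.prod_const, ← Finset.prod_mul_distrib]
  exact Finset.prod_pos fun i hi => by linarith [h i hi]

/-- For increasing nodes, exactly the `n - j` factors with larger index are negative; the sign is
written with `n + j`, which has the same parity. -/
lemma neg_one_pow_mul_eval_nodal_erase_pos {n : ℕ} {x : Fin (n + 1) → ℝ} (hx : StrictMono x)
    (j : Fin (n + 1)) :
    0 < (-1) ^ (n + j : ℕ) * (Lagrange.nodal (Finset.univ.erase j) x).eval (x j) := by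
  have h : Finset.univ.erase j = (Finset.Iio j).disjUnion (Finset.Ioi j)
      (Finset.disjoint_left.mpr fun i hi hi' =>
        (Finset.mem_Iio.mp hi).not_gt (Finset.mem_Ioi.mp hi')) := by
    ext i; simp [lt_or_lt_iff_ne]
  have h1 := eval_nodal_pos (s := Finset.Iio j) (v := x) (t := x j) fun i hi =>
    hx (Finset.mem_Iio.mp hi)
  have h2 := neg_one_pow_mul_eval_nodal_pos (s := Finset.Ioi j) (v := x) (t := x j) fun i hi =>
    hx (Finset.mem_Ioi.mp hi)
  have hpar : (-1 : ℝ) ^ (n + j : ℕ) = (-1) ^ (Finset.Ioi j).card := by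
    rw [Fin.card_Ioi, show n + (j : ℕ) = (n + 1 - 1 - j) + 2 * j by omega, pow_add, pow_mul]
    simp
  rw [hpar]
  rw [Lagrange.eval_nodal] at h1 h2 ⊢
  rw [h, Finset.prod_disjUnion]
  calc 0 < _ := mul_pos h1 h2
    _ = _ := by ring

/-! ### Existence of the quadrature rule -/

lemma lobattoNodes_injective {n : ℕ} {x : Fin (n + 1) → ℝ} (hx : StrictMono x)
    (hmem : ∀ j, x j ∈ Set.Ioo (-1 : ℝ) 1) : Function.Injective (lobattoNodes x) := by
  refine Function.Injective.sumElim hx.injective ?_ fun i k => ?_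
  · intro i k
    fin_cases i <;> fin_cases k <;> norm_num
  · fin_cases k
    · exact (hmem i).1.ne'
    · exact (hmem i).2.ne

lemma nodal_lobattoNodes {n : ℕ} (x : Fin (n + 1) → ℝ) :
    Lagrange.nodal Finset.univ (lobattoNodes x) =
      Lagrange.nodal Finset.univ x * ((X + 1) * (X - 1)) := by
  simp [Lagrange.nodal, Fintype.prod_sum_type, Fin.prod_univ_two, lobattoNodes]

/-- The interpolatory weights `∫ (1-t)^α (1+t)^β L_i(t) dt` work: dividing by the nodal polynomial,
which is `-(1-X²)` times a multiple of `P_{n+1}^{(α+1,β+1)}`, leaves a quotient of degree at most `n` that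
contributes nothing. -/
lemma exists_isJacobiLobattoRule {α β : ℝ} (hα : -1 < α) (hβ : -1 < β) (n : ℕ) :
    ∃ (x wt : Fin (n + 1) → ℝ) (wh : Fin 2 → ℝ), IsJacobiLobattoRule α β x wt wh := by
  have hα' : -1 < α + 1 := by linarith
  have hβ' : -1 < β + 1 := by linarith
  obtain ⟨x, hx, hroot⟩ := exists_strictMono_isRoot_jacobiPoly (n + 1) hα' hβ'
  have hinj := lobattoNodes_injective hx fun j => (hroot j).1
  set v := lobattoNodes x
  let w : Fin (n + 1) ⊕ Fin 2 → ℝ := fun i =>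
    jacobiIntegral hα hβ (Lagrange.basis Finset.univ v i)
  refine ⟨x, fun j => w (Sum.inl j), fun i => w (Sum.inr i), hx,
    range_eq_setOf_isRoot_jacobiPoly n.succ_ne_zero hα' hβ' hx fun j => (hroot j).2, fun p hp => ?_⟩
  rw [← jacobiIntegral_apply hα hβ]
  have hmonic : (Lagrange.nodal Finset.univ v).Monic := Lagrange.nodal_monic
  have hdeg : (Lagrange.nodal Finset.univ v).natDegree = n + 3 := by
    simp [Lagrange.natDegree_nodal, add_assoc]
  have hsplit := modByMonic_add_div p (Lagrange.nodal Finset.univ v)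
  set r := p %ₘ Lagrange.nodal Finset.univ v
  set q := p /ₘ Lagrange.nodal Finset.univ v with hq
  have hqdeg : q.natDegree ≤ n := by
    rw [hq, natDegree_divByMonic p hmonic, hdeg]
    omega
  have hquot : jacobiIntegral hα hβ (Lagrange.nodal Finset.univ v * q) = 0 := by
    rw [nodal_lobattoNodes, show Lagrange.nodal Finset.univ x * ((X + 1) * (X - 1)) * q =
      -((1 - X ^ 2) * (Lagrange.nodal Finset.univ x * q)) by ring, map_neg,
      ← jacobiIntegral_add_one_add_one hα hβ hα' hβ',
      jacobiIntegral_nodal_mul n.succ_ne_zero hα' hβ' hx (fun j => (hroot j).2) (by omega),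
      coeff_eq_zero_of_natDegree_lt (by omega), zero_mul, neg_zero]
  have hrdeg : r.degree < (Finset.univ : Finset (Fin (n + 1) ⊕ Fin 2)).card := by
    have h := degree_modByMonic_lt p hmonic
    rwa [Lagrange.degree_nodal] at h
  have hrem : jacobiIntegral hα hβ r = ∑ i, r.eval (v i) * w i := by
    conv_lhs => rw [Lagrange.eq_interpolate hinj.injOn hrdeg]
    rw [Lagrange.interpolate_apply, map_sum]
    exact Finset.sum_congr rfl fun i _ => jacobiIntegral_C_mul hα hβ _ _
  have heval : ∀ i, p.eval (v i) = r.eval (v i) := by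
    intro i
    rw [← hsplit, eval_add, eval_mul, Lagrange.eval_nodal_at_node (Finset.mem_univ i), zero_mul,
      add_zero]
  have h0 := heval (Sum.inr 0)
  have h1 := heval (Sum.inr 1)
  have hj := fun j => heval (Sum.inl j)
  simp only [v, lobattoNodes, Sum.elim_inl, Sum.elim_inr, Matrix.cons_val_zero,
    Matrix.cons_val_one] at h0 h1 hj
  conv_lhs => rw [← hsplit]
  rw [map_add, hquot, add_zero, hrem, Fintype.sum_sum_type, Fin.sum_univ_two]
  simp only [v, lobattoNodes, Sum.elim_inl, Sum.elim_inr, Matrix.cons_val_zero,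
    Matrix.cons_val_one, h0, h1, hj]
  simp only [mul_comm (eval _ r)]
  ring

/-! ### Quadrature weights in terms of barycentric weights -/

/-- The constant `K` such that `w̃_j = K λ̃_j²`, `(β+1) ŵ_1 = K λ̂_1²` and `(α+1) ŵ_2 = K λ̂_2²`. -/
def lobattoScale (α β : ℝ) (n : ℕ) : ℝ :=
  (α + 1 + (β + 1) + 2 * n + 3) * monicJacobiNormSq (n + 1) (α + 1) (β + 1)

lemma lobattoScale_pos {α β : ℝ} (hα : -1 < α) (hβ : -1 < β) (n : ℕ) : 0 < lobattoScale α β n := by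
  have hn : (0 : ℝ) ≤ n := Nat.cast_nonneg n
  exact mul_pos (by linarith)
    (monicJacobiNormSq_pos n.succ_ne_zero (by linarith) (by linarith))

namespace IsJacobiLobattoRule

variable {α β : ℝ} {n : ℕ} {x wt : Fin (n + 1) → ℝ} {wh : Fin 2 → ℝ}

lemma isRoot (h : IsJacobiLobattoRule α β x wt wh) (j : Fin (n + 1)) :
    (jacobiPoly (n + 1) (α + 1) (β + 1)).IsRoot (x j) := by
  have hj : x j ∈ {t : ℝ | (jacobiPoly (n + 1) (α + 1) (β + 1)).IsRoot t} :=
    h.range_eq ▸ Set.mem_range_self j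
  exact hj

lemma mem_Ioo (h : IsJacobiLobattoRule α β x wt wh) (hα : -1 < α) (hβ : -1 < β)
    (j : Fin (n + 1)) : x j ∈ Set.Ioo (-1 : ℝ) 1 :=
  mem_Ioo_of_isRoot_jacobiPoly n.succ_ne_zero (by linarith) (by linarith) (h.isRoot j)

lemma orthogonal (h : IsJacobiLobattoRule α β x wt wh) (hα' : -1 < α + 1)
    (hβ' : -1 < β + 1) {q : ℝ[X]} (hq : q.natDegree ≤ n + 1) :
    jacobiIntegral hα' hβ' (Lagrange.nodal Finset.univ x * q) =
      q.coeff (n + 1) * monicJacobiNormSq (n + 1) (α + 1) (β + 1) :=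
  jacobiIntegral_nodal_mul n.succ_ne_zero hα' hβ' h.strictMono h.isRoot hq

/-- Apply the rule to `(1 - X²) ℓ²`, where `ℓ` is the nodal polynomial of the other interior
nodes. -/
lemma interior_weight (h : IsJacobiLobattoRule α β x wt wh) (hα : -1 < α) (hβ : -1 < β)
    (j : Fin (n + 1)) :
    wt j = lobattoScale α β n * barycentricWeight (lobattoNodes x) (Sum.inl j) ^ 2 := by
  have hα' : -1 < α + 1 := by linarith
  have hβ' : -1 < β + 1 := by linarith
  set l := Lagrange.nodal (Finset.univ.erase j) x with hl
  have hlm : l.natDegree = n := by simp [hl, Lagrange.natDegree_nodal]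
  have hnorm := one_sub_sq_mul_jacobiIntegral_sq hα' hβ' (Lagrange.nodal_monic : l.Monic) hlm
    (Lagrange.nodal_eq_mul_nodal_erase (Finset.mem_univ j)) fun q hq => h.orthogonal hα' hβ' hq
  have hdeg : ((1 - X ^ 2) * l ^ 2).natDegree ≤ 2 * n + 3 := by
    have h1 : (1 - X ^ 2 : ℝ[X]).natDegree ≤ 2 :=
      natDegree_sub_le_of_degree_le (by simp) (natDegree_X_pow_le 2)
    refine (natDegree_mul_le_of_le h1 (natDegree_pow_le_of_le 2 hlm.le)).trans (by omega)
  have hex := h.exact_of_le _ hdeg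
  rw [← jacobiIntegral_apply hα hβ, ← jacobiIntegral_add_one_add_one hα hβ hα' hβ',
    Finset.sum_eq_single j] at hex
  · have hlj : l.eval (x j) ≠ 0 := by
      have := neg_one_pow_mul_eval_nodal_erase_pos h.strictMono j
      exact right_ne_zero_of_mul this.ne'
    have hx := h.mem_Ioo hα hβ j
    have hx1 : x j + 1 ≠ 0 := by linarith [hx.1]
    have hx2 : x j - 1 ≠ 0 := by linarith [hx.2]
    simp only [eval_mul, eval_sub, eval_one, eval_pow, eval_X] at hex
    rw [hex] at hnorm
    rw [barycentricWeight_lobattoNodes_inl, ← hl, lobattoScale, ← hnorm]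
    field_simp
    ring
  · intro i _ hij
    rw [eval_mul, eval_pow, hl,
      Lagrange.eval_nodal_at_node (Finset.mem_erase.mpr ⟨hij, Finset.mem_univ i⟩)]
    ring
  · simp

lemma sum_eval_mul_nodal_sq (r : ℝ[X]) :
    ∑ j, wt j * (r * Lagrange.nodal Finset.univ x ^ 2).eval (x j) = 0 := by
  refine Finset.sum_eq_zero fun j hj => ?_
  rw [eval_mul, eval_pow, Lagrange.eval_nodal_at_node hj]
  ring

/-- Apply the rule to `(1 - X) p²`, where `p` is the nodal polynomial of the interior nodes. -/
lemma left_weight (h : IsJacobiLobattoRule α β x wt wh) (hα : -1 < α) (hβ : -1 < β) :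
    (β + 1) * wh 0 =
      lobattoScale α β n * barycentricWeight (lobattoNodes x) (Sum.inr 0) ^ 2 := by
  have hα' : -1 < α + 1 := by linarith
  have hβ' : -1 < β + 1 := by linarith
  have hpm : (Lagrange.nodal Finset.univ x).natDegree = n + 1 := by simp [Lagrange.natDegree_nodal]
  have hnorm := jacobiIntegral_sq_of_orthogonal_right hα' hβ hβ' Lagrange.nodal_monic hpm
    fun q hq => h.orthogonal hα' hβ' hq
  have hdeg : ((1 - X) * Lagrange.nodal Finset.univ x ^ 2).natDegree ≤ 2 * n + 3 := by
    have h1 : (1 - X : ℝ[X]).natDegree ≤ 1 :=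
      natDegree_sub_le_of_degree_le (by simp) natDegree_X_le
    refine (natDegree_mul_le_of_le h1 (natDegree_pow_le_of_le 2 hpm.le)).trans (by omega)
  have hex := h.exact_of_le _ hdeg
  rw [← jacobiIntegral_apply hα hβ, ← jacobiIntegral_add_one_left hα hβ hα',
    sum_eval_mul_nodal_sq] at hex
  have hp : (Lagrange.nodal Finset.univ x).eval (-1) ≠ 0 :=
    right_ne_zero_of_mul (neg_one_pow_mul_eval_nodal_pos fun i _ => (h.mem_Ioo hα hβ i).1).ne'
  simp only [eval_mul, eval_sub, eval_one, eval_pow, eval_X] at hex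
  rw [hex] at hnorm
  have hK : lobattoScale α β n = (α + 1 + β + 2 * (n + 1 : ℕ) + 2) *
      monicJacobiNormSq (n + 1) (α + 1) (β + 1) := by
    rw [lobattoScale]; push_cast; ring
  rw [barycentricWeight_lobattoNodes_inr_zero, hK, ← hnorm]
  field_simp
  ring

/-- Apply the rule to `(1 + X) p²`, where `p` is the nodal polynomial of the interior nodes. -/
lemma right_weight (h : IsJacobiLobattoRule α β x wt wh) (hα : -1 < α) (hβ : -1 < β) :
    (α + 1) * wh 1 =
      lobattoScale α β n * barycentricWeight (lobattoNodes x) (Sum.inr 1) ^ 2 := by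
  have hα' : -1 < α + 1 := by linarith
  have hβ' : -1 < β + 1 := by linarith
  have hpm : (Lagrange.nodal Finset.univ x).natDegree = n + 1 := by simp [Lagrange.natDegree_nodal]
  have hnorm := jacobiIntegral_sq_of_orthogonal_left hα hβ' hα' Lagrange.nodal_monic hpm
    fun q hq => h.orthogonal hα' hβ' hq
  have hdeg : ((1 + X) * Lagrange.nodal Finset.univ x ^ 2).natDegree ≤ 2 * n + 3 := by
    have h1 : (1 + X : ℝ[X]).natDegree ≤ 1 :=
      natDegree_add_le_of_degree_le (by simp) natDegree_X_le
    refine (natDegree_mul_le_of_le h1 (natDegree_pow_le_of_le 2 hpm.le)).trans (by omega)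
  have hex := h.exact_of_le _ hdeg
  rw [← jacobiIntegral_apply hα hβ, ← jacobiIntegral_add_one_right hα hβ hβ',
    sum_eval_mul_nodal_sq] at hex
  have hp : (Lagrange.nodal Finset.univ x).eval 1 ≠ 0 :=
    (eval_nodal_pos fun i _ => (h.mem_Ioo hα hβ i).2).ne'
  simp only [eval_mul, eval_add, eval_one, eval_pow, eval_X] at hex
  rw [hex] at hnorm
  have hK : lobattoScale α β n = (α + (β + 1) + 2 * (n + 1 : ℕ) + 2) *
      monicJacobiNormSq (n + 1) (α + 1) (β + 1) := by
    rw [lobattoScale]; push_cast; ring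
  rw [barycentricWeight_lobattoNodes_inr_one, hK, ← hnorm]
  field_simp
  ring

end IsJacobiLobattoRule

/-! ### Signs of the barycentric weights -/

lemma barycentricWeight_lobattoNodes_inl_sign {n : ℕ} {x : Fin (n + 1) → ℝ} (hx : StrictMono x)
    (hmem : ∀ j, x j ∈ Set.Ioo (-1 : ℝ) 1) (j : Fin (n + 1)) :
    0 < (-1) ^ n * (-1) ^ ((j : ℕ) + 1) * barycentricWeight (lobattoNodes x) (Sum.inl j) := by
  have h := neg_one_pow_mul_eval_nodal_erase_pos hx j
  have h1 : 0 < (x j + 1) * (1 - x j) := mul_pos (by linarith [(hmem j).1])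
    (by linarith [(hmem j).2])
  rw [barycentricWeight_lobattoNodes_inl]
  set e := (Lagrange.nodal (Finset.univ.erase j) x).eval (x j)
  have hs : ((-1 : ℝ) ^ (n + j : ℕ)) * (-1) ^ (n + j : ℕ) = 1 := by
    rw [← mul_pow]; simp
  have hpos := one_div_pos.mpr (mul_pos h h1)
  have he : e ≠ 0 := right_ne_zero_of_mul h.ne'
  refine hpos.trans_eq (Eq.symm ?_)
  have hx1 : x j + 1 ≠ 0 := left_ne_zero_of_mul h1.ne'
  have hx2 : 1 - x j ≠ 0 := right_ne_zero_of_mul h1.ne'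
  have hx3 : x j - 1 ≠ 0 := by rw [← neg_sub]; exact neg_ne_zero.mpr hx2
  rw [mul_one_div, div_eq_div_iff (by positivity) (mul_pos h h1).ne', ← pow_add,
    ← add_assoc, pow_succ]
  linear_combination (-e * ((x j + 1) * (1 - x j))) * hs

/-- If `w = K λ²` and `ε = ±1` carries the sign of `λ`, then `λ = ε √w / √K`. -/
lemma eq_div_sqrt_mul_sqrt {K w l ε : ℝ} (hK : 0 < K) (hw : w = K * l ^ 2) (hε : ε ^ 2 = 1)
    (hl : 0 < ε * l) : l = ε / √K * √w := by
  have h : √(l ^ 2) = ε * l := by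
    rw [← one_mul (l ^ 2), ← hε, ← mul_pow, Real.sqrt_sq hl.le]
  have hs : √K ≠ 0 := (Real.sqrt_pos.mpr hK).ne'
  rw [hw, Real.sqrt_mul hK.le, h]
  field_simp
  linear_combination (-l) * hε

end

theorem theorem3p2 (α β : ℝ) (hα : -1 < α) (hβ : -1 < β) (n : ℕ) :
    (∃ (x wt : Fin (n + 1) → ℝ) (wh : Fin 2 → ℝ), IsJacobiLobattoRule α β x wt wh) ∧
    ∀ (x wt : Fin (n + 1) → ℝ) (wh : Fin 2 → ℝ), IsJacobiLobattoRule α β x wt wh →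
      (∀ j : Fin (n + 1), 0 < wt j) ∧ 0 < wh 0 ∧ 0 < wh 1 ∧
      (∀ j : Fin (n + 1), barycentricWeight (lobattoNodes x) (Sum.inl j) =
        jacobiC n (α + 1) (β + 1) * (-1) ^ ((j : ℕ) + 1) * √(wt j)) ∧
      barycentricWeight (lobattoNodes x) (Sum.inr 0) =
        jacobiC n (α + 1) (β + 1) * √((β + 1) * wh 0) ∧
      barycentricWeight (lobattoNodes x) (Sum.inr 1) =
        jacobiC n (α + 1) (β + 1) * (-1) ^ n * √((α + 1) * wh 1) ∧
      IsSimplifiedBarycentricWeight (lobattoNodes x)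
        (Sum.elim (fun j : Fin (n + 1) => (-1) ^ ((j : ℕ) + 1) * √(wt j))
          ![√((β + 1) * wh 0), (-1) ^ n * √((α + 1) * wh 1)]) := by
  refine ⟨exists_isJacobiLobattoRule hα hβ n, fun x wt wh h => ?_⟩
  have hK := lobattoScale_pos hα hβ n
  have hC : jacobiC n (α + 1) (β + 1) = (-1) ^ n / √(lobattoScale α β n) :=
    jacobiC_eq n (by linarith) (by linarith)
  have hmem := h.mem_Ioo hα hβ
  have hsq : ∀ k : ℕ, ((-1 : ℝ) ^ k) ^ 2 = 1 := fun k => by rw [← pow_mul, mul_comm, pow_mul]; simp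
  have sj := barycentricWeight_lobattoNodes_inl_sign h.strictMono hmem
  have s0 : 0 < (-1) ^ n * barycentricWeight (lobattoNodes x) (Sum.inr 0) := by
    have hp := neg_one_pow_mul_eval_nodal_pos (s := Finset.univ) fun i _ => (hmem i).1
    rw [Finset.card_univ, Fintype.card_fin] at hp
    have he := right_ne_zero_of_mul hp.ne'
    rw [barycentricWeight_lobattoNodes_inr_zero]
    refine (one_div_pos.mpr (mul_pos hp two_pos)).trans_eq (Eq.symm ?_)
    rw [mul_one_div, div_eq_div_iff (mul_ne_zero he (by norm_num)) (mul_pos hp two_pos).ne',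
      pow_succ]
    linear_combination (-2 * (Lagrange.nodal Finset.univ x).eval (-1)) * hsq n
  have s1 : 0 < barycentricWeight (lobattoNodes x) (Sum.inr 1) := by
    rw [barycentricWeight_lobattoNodes_inr_one]
    exact one_div_pos.mpr (mul_pos (eval_nodal_pos fun i _ => (hmem i).2) two_pos)
  have wj := h.interior_weight hα hβ
  have w0 := h.left_weight hα hβ
  have w1 := h.right_weight hα hβ
  have fj : ∀ j : Fin (n + 1), barycentricWeight (lobattoNodes x) (Sum.inl j) =
      jacobiC n (α + 1) (β + 1) * (-1) ^ ((j : ℕ) + 1) * √(wt j) := by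
    intro j
    rw [hC, div_mul_eq_mul_div]
    exact eq_div_sqrt_mul_sqrt hK (wj j) (by rw [mul_pow, hsq, hsq, one_mul]) (sj j)
  have f0 : barycentricWeight (lobattoNodes x) (Sum.inr 0) =
      jacobiC n (α + 1) (β + 1) * √((β + 1) * wh 0) := by
    rw [hC]
    exact eq_div_sqrt_mul_sqrt hK w0 (hsq n) s0
  have f1 : barycentricWeight (lobattoNodes x) (Sum.inr 1) =
      jacobiC n (α + 1) (β + 1) * (-1) ^ n * √((α + 1) * wh 1) := by
    rw [hC, div_mul_eq_mul_div, ← sq, hsq]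
    exact eq_div_sqrt_mul_sqrt hK w1 (one_pow 2) (by rwa [one_mul])
  refine ⟨fun j => ?_, ?_, ?_, fj, f0, f1, jacobiC n (α + 1) (β + 1), ?_, ?_⟩
  · rw [wj j]
    exact mul_pos hK (sq_pos_of_ne_zero (right_ne_zero_of_mul (sj j).ne'))
  · refine pos_of_mul_pos_right (a := β + 1) ?_ (by linarith)
    rw [w0]
    exact mul_pos hK (sq_pos_of_ne_zero (right_ne_zero_of_mul s0.ne'))
  · refine pos_of_mul_pos_right (a := α + 1) ?_ (by linarith)
    rw [w1]
    exact mul_pos hK (sq_pos_of_ne_zero s1.ne')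
  · rw [hC]
    exact div_ne_zero (pow_ne_zero _ (by norm_num)) (Real.sqrt_pos.mpr hK).ne'
  · rintro (j | i)
    · rw [fj j, Sum.elim_inl, mul_assoc]
    · fin_cases i
      · exact f0
      · exact f1.trans (mul_assoc _ _ _)
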